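/- Let $|\cdot|$ be a norm on $\mathbb R^n$ with induced operator norm $\|\cdot\|$ on $\mathbb R^{n\times n}$, and let $\mu(A)=\lim_{s\searrow 0}\frac{\|I+sA\|-1}{s}$ be the corresponding matrix measure. Consider the system $\dot x=f(t,x)$, $t\ge t_0$, in $\mathbb R^n$, where $f$ is piecewise continuous in $t$ and continuously differentiable in $x$; that is, $f(t,\cdot)$ is $C^1$ for each $t\ge t_0$, and there is a set $D$ of times, finite on each bounded interval, such that $f$ and $\partial f/\partial x$ are continuous in $(t,x)$ for $t\in[t_0,\infty)\setminus D$ and have one-sided limits, locally uniformly in $x$, as $t$ tends to a point of $D$. Assume that the system is forward complete: for all $t_1\ge t_0$ and $x\in\mathbb R^n$ it has an (absolutely continuous) solution on $[t_1,\infty)$ with value $x$ at time $t_1$; this solution is unique, and $\xi(t,t_1,x)$ denotes its value at time $t\ge t_1$. Write $\xi(t_1,t_0,K)=\{\xi(t_1,t_0,x):x\in K\}$ for the reachable set at time $t_1$. Let $K\subset\mathbb R^n$ be compact with nonempty interior. For $\varepsilon>0$ and $T\ge 0$ let $S(f,t_0,\varepsilon,T,K)$ be the minimal cardinality of a set $F\subset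 K$ such that for every $\bar x\in K$ there is $x\in F$ with $|\xi(t,t_0,\bar x)-\xi(t,t_0,x)|<\varepsilon$ for all $t\in[t_0,t_0+T]$, and let $$h(f,t_0,K)=\lim_{\varepsilon\searrow 0}\limsup_{T\to\infty}\frac1T\log S(f,t_0,\varepsilon,T,K)$$ be the topological entropy. Then, with values in $[-\infty,\infty]$, $$h(f,t_0,K)\le n\max\{\hat\mu^*,0\},\qquad \hat\mu^*:=\inf_{t_1\ge t_0}\ \limsup_{t\to\infty}\ \max_{v\in\mathrm{co}(\xi(t_1,t_0,K))}\mu\!\left(\frac{\partial f}{\partial x}\big(t,\xi(t,t_1,v)\big)\right),$$ where $\mathrm{co}$ denotes the convex hull. -/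

import Mathlib

open Set Filter Topology

namespace TVEntropy

variable {E : Type*} [NormedAddCommGroup E] [NormedSpace ℝ E]

/-- Standing regularity of the right-hand side of `x' = f(t, x)`, `t ≥ t₀`: `f` is piecewise
continuous in `t` and continuously differentiable in `x`.  There is a set `D` of exceptional times,
finite on every bounded interval, such that `f` and its Jacobian `∂f/∂x` are continuous in `(t, x)`
for `t ∉ D`, and both have one-sided limits (locally uniformly in `x`) as `t` approaches a point
of `D`. -/
structure IsPiecewiseC1 (f : ℝ → E → E) (t₀ : ℝ) : Prop where
  contDiff : ∀ t, t₀ ≤ t → ContDiff ℝ 1 (f t)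
  piecewise : ∃ D : Set ℝ, (∀ b : ℝ, (D ∩ Icc t₀ b).Finite) ∧
    ContinuousOn (fun p : ℝ × E => f p.1 p.2) ((Ici t₀ \ D) ×ˢ univ) ∧
    ContinuousOn (fun p : ℝ × E => fderiv ℝ (f p.1) p.2) ((Ici t₀ \ D) ×ˢ univ) ∧
    (∀ τ ∈ D, t₀ ≤ τ → ∀ x : E,
      (∃ l, Tendsto (fun p : ℝ × E => f p.1 p.2) (𝓝[>] τ ×ˢ 𝓝 x) (𝓝 l)) ∧
      (∃ L, Tendsto (fun p : ℝ × E => fderiv ℝ (f p.1) p.2) (𝓝[>] τ ×ˢ 𝓝 x) (𝓝 L))) ∧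
    (∀ τ ∈ D, t₀ < τ → ∀ x : E,
      (∃ l, Tendsto (fun p : ℝ × E => f p.1 p.2) (𝓝[<] τ ×ˢ 𝓝 x) (𝓝 l)) ∧
      (∃ L, Tendsto (fun p : ℝ × E => fderiv ℝ (f p.1) p.2) (𝓝[<] τ ×ˢ 𝓝 x) (𝓝 L)))

/-- `γ` is a solution on `[t₁, ∞)` of `x' = f(t, x)` with `γ t₁ = x`, in integral form (that is,
`γ` is locally absolutely continuous and satisfies the differential equation almost everywhere). -/
structure IsSolution (f : ℝ → E → E) (t₁ : ℝ) (x : E) (γ : ℝ → E) : Prop where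
  continuousOn : ContinuousOn γ (Ici t₁)
  intervalIntegrable : ∀ t, t₁ ≤ t →
    IntervalIntegrable (fun s => f s (γ s)) MeasureTheory.volume t₁ t
  eq_integral : ∀ t, t₁ ≤ t → γ t = x + ∫ s in t₁..t, f s (γ s)

/-- Forward completeness: from every initial time `t₁ ≥ t₀` and every initial state there is a
solution on all of `[t₁, ∞)`. -/
def ForwardComplete (f : ℝ → E → E) (t₀ : ℝ) : Prop :=
  ∀ t₁, t₀ ≤ t₁ → ∀ x : E, ∃ γ : ℝ → E, IsSolution f t₁ x γ

open Classical in
/-- `sol f t t₁ x` is the value at time `t ≥ t₁` of the solution `ξ(t, t₁, x)` with initial state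
`x` at time `t₁` (which is unique under the standing regularity); the value is meaningless
if there is no global forward solution. -/
noncomputable def sol (f : ℝ → E → E) (t t₁ : ℝ) (x : E) : E :=
  if h : ∃ γ : ℝ → E, IsSolution f t₁ x γ then h.choose t else x

/-- The ball `B_{f,t₀}(x, ε, T)` of initial states whose trajectories stay `ε`-close to that of `x`
on `[t₀, t₀ + T]`. -/
def dynBall (f : ℝ → E → E) (t₀ : ℝ) (x : E) (ε T : ℝ) : Set E :=
  {y | ∀ t ∈ Icc t₀ (t₀ + T), ‖sol f t t₀ y - sol f t t₀ x‖ < ε}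

/-- `F ⊆ K` is `(T, ε)`-spanning for the initial set `K` at initial time `t₀`. -/
def IsSpanning (f : ℝ → E → E) (t₀ ε T : ℝ) (K F : Set E) : Prop :=
  F ⊆ K ∧ K ⊆ ⋃ x ∈ F, dynBall f t₀ x ε T

/-- `S(f, t₀, ε, T, K)`: the minimal cardinality of a `(T, ε)`-spanning set. -/
noncomputable def spanCard (f : ℝ → E → E) (t₀ ε T : ℝ) (K : Set E) : ℕ∞ :=
  ⨅ (F : Set E) (_ : IsSpanning f t₀ ε T K F), F.encard

/-- The exponential growth rate `limsup_{T → ∞} (1 / T) log S(f, t₀, ε, T, K)`. -/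
noncomputable def spanRate (f : ℝ → E → E) (t₀ ε : ℝ) (K : Set E) : EReal :=
  limsup (fun T : ℝ => ENNReal.log (spanCard f t₀ ε T K : ENNReal) / (T : EReal)) atTop

/-- The topological entropy `h(f, t₀, K)`: the limit as `ε ↘ 0` of the growth rate.  The rate is
nonincreasing in `ε`, so that the limit is the supremum over `ε > 0`; see `tendsto_spanRate`. -/
noncomputable def entropy (f : ℝ → E → E) (t₀ : ℝ) (K : Set E) : EReal :=
  ⨆ (ε : ℝ) (_ : 0 < ε), spanRate f t₀ ε K

/-- The matrix measure (logarithmic norm) `μ(A) = lim_{t ↘ 0} (‖I + tA‖ - 1) / t` with respect to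
the operator norm; the limit exists, see `tendsto_matrixMeasure`. -/
noncomputable def matrixMeasure (A : E →L[ℝ] E) : ℝ :=
  limUnder (𝓝[>] (0 : ℝ))
    (fun t : ℝ => (‖ContinuousLinearMap.id ℝ E + t • A‖ - 1) / t)

/-- The constant
`μ̂* = inf_{t₁ ≥ t₀} limsup_{t → ∞} max_{v ∈ co(ξ(t₁, t₀, K))} μ(∂f/∂x(t, ξ(t, t₁, v)))`,
an extended real number. -/
noncomputable def muHatStar (f : ℝ → E → E) (t₀ : ℝ) (K : Set E) : EReal :=
  ⨅ (t₁ : ℝ) (_ : t₀ ≤ t₁), limsup (fun t : ℝ =>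
    ⨆ v ∈ convexHull ℝ ((fun x => sol f t₁ t₀ x) '' K),
      (matrixMeasure (fderiv ℝ (f t) (sol f t t₁ v)) : EReal)) atTop

theorem dynBall_mono (f : ℝ → E → E) (t₀ : ℝ) (x : E) (T : ℝ) {ε ε' : ℝ} (h : ε ≤ ε') :
    dynBall f t₀ x ε T ⊆ dynBall f t₀ x ε' T :=
  fun _ hy t ht => (hy t ht).trans_le h

theorem spanCard_antitone (f : ℝ → E → E) (t₀ T : ℝ) (K : Set E) :
    Antitone (fun ε => spanCard f t₀ ε T K) := by
  intro ε ε' h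
  refine le_iInf₂ fun F hF => iInf₂_le F ⟨hF.1, hF.2.trans ?_⟩
  exact iUnion₂_mono fun x _ => dynBall_mono f t₀ x T h

theorem spanRate_antitone (f : ℝ → E → E) (t₀ : ℝ) (K : Set E) :
    Antitone (fun ε => spanRate f t₀ ε K) := by
  intro ε ε' h
  refine limsup_le_limsup ?_
  filter_upwards [eventually_ge_atTop (0 : ℝ)] with T hT
  refine EReal.div_le_div_right_of_nonneg (by exact_mod_cast hT) ?_
  exact ENNReal.log_monotone (by exact_mod_cast spanCard_antitone f t₀ T K h)

/-- The entropy is the limit of the growth rates as `ε ↘ 0`. -/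
theorem tendsto_spanRate (f : ℝ → E → E) (t₀ : ℝ) (K : Set E) :
    Tendsto (fun ε => spanRate f t₀ ε K) (𝓝[>] 0) (𝓝 (entropy f t₀ K)) := by
  have h := (spanRate_antitone f t₀ K).tendsto_nhdsGT 0
  rwa [sSup_image] at h

/-- The limit that defines the matrix measure exists. -/
theorem tendsto_matrixMeasure [Nontrivial E] (A : E →L[ℝ] E) :
    Tendsto (fun t : ℝ => (‖ContinuousLinearMap.id ℝ E + t • A‖ - 1) / t) (𝓝[>] (0 : ℝ))
      (𝓝 (matrixMeasure A)) := by
  have h1 : ‖ContinuousLinearMap.id ℝ E‖ = 1 := ContinuousLinearMap.norm_id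
  have hmono : MonotoneOn
      (fun t : ℝ => (‖ContinuousLinearMap.id ℝ E + t • A‖ - 1) / t) (Ioi 0) := by
    intro s hs t ht hst
    have hs' : (0 : ℝ) < s := hs
    have ht' : (0 : ℝ) < t := ht
    have key : ContinuousLinearMap.id ℝ E + s • A
        = (1 - s / t) • ContinuousLinearMap.id ℝ E
          + (s / t) • (ContinuousLinearMap.id ℝ E + t • A) := by
      rw [smul_add, smul_smul, div_mul_cancel₀ _ ht'.ne', sub_smul, one_smul]
      abel
    have hr : s / t ≤ 1 := (div_le_one ht').2 hst
    have hr0 : 0 ≤ s / t := by positivity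
    have hn : ‖ContinuousLinearMap.id ℝ E + s • A‖
        ≤ (1 - s / t) + (s / t) * ‖ContinuousLinearMap.id ℝ E + t • A‖ := by
      rw [key]
      refine (norm_add_le _ _).trans ?_
      rw [norm_smul, norm_smul, h1, Real.norm_of_nonneg (sub_nonneg.2 hr),
        Real.norm_of_nonneg hr0, mul_one]
    change (‖ContinuousLinearMap.id ℝ E + s • A‖ - 1) / s
      ≤ (‖ContinuousLinearMap.id ℝ E + t • A‖ - 1) / t
    rw [div_le_div_iff₀ hs' ht']
    have := mul_le_mul_of_nonneg_right hn ht'.le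
    have e : ((1 - s / t) + (s / t) * ‖ContinuousLinearMap.id ℝ E + t • A‖) * t
        = t - s + s * ‖ContinuousLinearMap.id ℝ E + t • A‖ := by
      field_simp
    rw [e] at this
    linarith
  have hbdd : BddBelow
      ((fun t : ℝ => (‖ContinuousLinearMap.id ℝ E + t • A‖ - 1) / t) '' Ioi 0) := by
    refine ⟨-‖A‖, ?_⟩
    rintro _ ⟨t, ht, rfl⟩
    have ht' : (0 : ℝ) < t := ht
    change -‖A‖ ≤ (‖ContinuousLinearMap.id ℝ E + t • A‖ - 1) / t
    rw [le_div_iff₀ ht']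
    have := norm_sub_le (ContinuousLinearMap.id ℝ E + t • A) (t • A)
    rw [add_sub_cancel_right, h1, norm_smul, Real.norm_of_nonneg ht'.le] at this
    linarith
  exact tendsto_nhds_limUnder ⟨_, hmono.tendsto_nhdsGT hbdd⟩

end TVEntropy

/-! Fix a real `κ > max (μ̂*) 0` and a `c < κ` still above that maximum. For some `t₁`, from a time
`t₂` on, the matrix measure of the Jacobian is at most `c` along every trajectory issued from the
convex hull of the reachable set at `t₁`. The aim is a bound `L e^{κ(t - t₀)}` for the Lipschitz
constant of `ξ(t, t₀, ·)` on `K` (`exists_norm_sol_sub_le`).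

If `g` is the difference of two solutions and `A` the Jacobian along the first, then `g' = A g` up
to an error `(κ - c)‖g‖` as long as `g` is small. Hence `‖g‖` has right slopes at most `κ‖g‖`, and
Gronwall gives the rate `κ` (`IsExceptionalSet.exists_norm_sub_le`). This holds only for initial
states within some `δ`, and `δ` shrinks as the time horizon grows. Subdividing the segment between
two initial states removes `δ` from the estimate (`norm_sub_le_of_locally_on_segment`); the segment
must then satisfy the bound on the measure, which is why the convex hull appears. Up to time `t₂`
local Lipschitz estimates suffice.

With such a Lipschitz bound, covering `K` by balls of radius proportional to `ε e^{-κT}` yields a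
spanning set. By volume it needs only a constant times `e^{nκT}` points
(`entropy_le_of_norm_sol_sub_le`), so the entropy is at most `nκ`; then `κ` decreases to the
maximum. -/

namespace TVEntropy

/-! ### Gronwall with exceptional times, and local bounds on the Jacobian -/

/-- Gronwall's inequality with finitely many exceptional times, where the growth condition is
required only as long as the function stays below a threshold that it cannot reach. -/
theorem le_mul_exp_of_frequently_slope_lt {φ : ℝ → ℝ} {D : Set ℝ} {a b κ ρ : ℝ}
    (hφ : ContinuousOn φ (Icc a b)) (hD : (D ∩ Icc a b).Finite) (hκ : 0 ≤ κ)
    (h0 : 0 ≤ φ a) (hρ : φ a * Real.exp (κ * (b - a)) < ρ)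
    (hslope : ∀ t ∈ Ico a b, t ∉ D → φ t < ρ → ∀ r, κ * φ t < r →
      ∃ᶠ s in 𝓝[>] t, (s - t)⁻¹ * (φ s - φ t) < r) :
    ∀ t ∈ Icc a b, φ t ≤ φ a * Real.exp (κ * (t - a)) := by
  have hcl : IsClosed ({t | φ t ≤ φ a * Real.exp (κ * (t - a))} ∩ Icc a b) := by
    have := isClosed_Icc.isClosed_le hφ
      (g := fun t => φ a * Real.exp (κ * (t - a))) (by fun_prop)
    convert this using 1
    ext t; simp [and_comm]
  refine hcl.Icc_subset_of_forall_mem_nhdsWithin (by simp) ?_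
  rintro t ⟨ht, hat, htb⟩
  simp only [mem_ofPred_eq] at ht
  -- As `φ a` and `κ` are nonnegative, the bound at `t` is at most its value at `b`, hence below
  -- `ρ`: the slope condition stays in force.
  have hlt : φ t < ρ := by
    refine ht.trans_lt (lt_of_le_of_lt ?_ hρ)
    gcongr
  have hct : ContinuousWithinAt φ (Ioi t) t :=
    ((hφ t ⟨hat, htb.le⟩).mono_of_mem_nhdsWithin
      (mem_of_superset (Ioc_mem_nhdsGT htb) fun s hs => ⟨hat.trans hs.1.le, hs.2⟩))
  have h1 : ∀ᶠ s in 𝓝[>] t, φ s < ρ := hct (Iio_mem_nhds hlt)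
  have h2 : ∀ᶠ s in 𝓝[>] t, s ∉ D ∩ Icc a b := by
    have hc : IsClosed ((D ∩ Icc a b) \ {t}) := (hD.subset sdiff_subset).isClosed
    have : ((D ∩ Icc a b) \ {t})ᶜ ∈ 𝓝 t := hc.isOpen_compl.mem_nhds (by simp)
    filter_upwards [nhdsWithin_le_nhds this, self_mem_nhdsWithin] with s hs hst hsD
    exact hs ⟨hsD, (ne_of_gt hst : s ≠ t)⟩
  obtain ⟨u, hu, hsub⟩ := (mem_nhdsGT_iff_exists_Ioo_subset).1 (h1.and (h2.and (Ioc_mem_nhdsGT htb)))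
  refine mem_of_superset (Ioo_mem_nhdsGT hu) fun s hs => ?_
  have hsb : s ≤ b := (hsub hs).2.2.2
  -- The time `t` may be exceptional, but no time in `(t, u)` is. Gronwall is therefore applied from
  -- `t' > t`, and `t'` tends to `t` by continuity.
  have key : ∀ᶠ t' in 𝓝[>] t, φ s ≤ φ t' * Real.exp (κ * (s - t')) := by
    filter_upwards [Ioo_mem_nhdsGT hs.1] with t' ht'
    have := le_gronwallBound_of_liminf_deriv_right_le (f := φ) (f' := fun x => κ * φ x)
      (δ := φ t') (K := κ) (ε := 0) (a := t') (b := s)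
      (hφ.mono (Icc_subset_Icc (hat.trans ht'.1.le) hsb)) ?_ le_rfl (by simp) s
      ⟨ht'.2.le, le_rfl⟩
    · rwa [gronwallBound_ε0] at this
    · intro x hx
      have hxm : x ∈ Ioo t u := ⟨ht'.1.trans_le hx.1, hx.2.trans hs.2⟩
      have hxI : x ∈ Ico a b := ⟨hat.trans hxm.1.le, hx.2.trans_le hsb⟩
      exact hslope x hxI (fun hxD => (hsub hxm).2.1 ⟨hxD, hxI.1, hxI.2.le⟩) (hsub hxm).1
  have hlim : Tendsto (fun t' => φ t' * Real.exp (κ * (s - t'))) (𝓝[>] t)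
      (𝓝 (φ t * Real.exp (κ * (s - t)))) := by
    refine Tendsto.mul hct ?_
    exact ((by fun_prop : Continuous fun t' => Real.exp (κ * (s - t'))).tendsto t).mono_left
      nhdsWithin_le_nhds
  have h3 : φ s ≤ φ t * Real.exp (κ * (s - t)) := ge_of_tendsto hlim key
  change φ s ≤ _
  calc φ s ≤ φ t * Real.exp (κ * (s - t)) := h3
    _ ≤ φ a * Real.exp (κ * (t - a)) * Real.exp (κ * (s - t)) := by gcongr
    _ = φ a * Real.exp (κ * (s - a)) := by
      rw [mul_assoc, ← Real.exp_add]; ring_nf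

variable {E : Type*} [NormedAddCommGroup E] [NormedSpace ℝ E]

/-- `D` is a set of exceptional times for the right-hand side `f` on `[t₀, ∞)`: the part of the
piecewise regularity of `f` that controls solutions. -/
structure IsExceptionalSet (f : ℝ → E → E) (t₀ : ℝ) (D : Set ℝ) : Prop where
  contDiff : ∀ t, t₀ ≤ t → ContDiff ℝ 1 (f t)
  finite : ∀ b : ℝ, (D ∩ Icc t₀ b).Finite
  continuousOn : ContinuousOn (fun p : ℝ × E => f p.1 p.2) ((Ici t₀ \ D) ×ˢ univ)
  continuousOn_fderiv :
    ContinuousOn (fun p : ℝ × E => fderiv ℝ (f p.1) p.2) ((Ici t₀ \ D) ×ˢ univ)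
  tendsto_right : ∀ τ ∈ D, t₀ ≤ τ → ∀ x : E,
    ∃ L, Tendsto (fun p : ℝ × E => fderiv ℝ (f p.1) p.2) (𝓝[>] τ ×ˢ 𝓝 x) (𝓝 L)
  tendsto_left : ∀ τ ∈ D, t₀ < τ → ∀ x : E,
    ∃ L, Tendsto (fun p : ℝ × E => fderiv ℝ (f p.1) p.2) (𝓝[<] τ ×ˢ 𝓝 x) (𝓝 L)

theorem IsPiecewiseC1.exists_isExceptionalSet {f : ℝ → E → E} {t₀ : ℝ}
    (hf : IsPiecewiseC1 f t₀) : ∃ D, IsExceptionalSet f t₀ D := by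
  obtain ⟨D, h1, h2, h3, h4, h5⟩ := hf.piecewise
  exact ⟨D, hf.contDiff, h1, h2, h3, fun τ hτ h x => (h4 τ hτ h x).2,
    fun τ hτ h x => (h5 τ hτ h x).2⟩

/-- Convergence along the product filter makes the neighbourhood `V` independent of the time `s`; on
it all values lie within `η / 2` of the limit. -/
theorem exists_nhds_bound_of_tendsto {J : ℝ → E → E →L[ℝ] E} {l : Filter ℝ} {x : E}
    (hJ : ∃ L, Tendsto (fun p : ℝ × E => J p.1 p.2) (l ×ˢ 𝓝 x) (𝓝 L)) {η : ℝ} (hη : 0 < η) :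
    ∃ V ∈ 𝓝 x, ∃ M, ∀ᶠ s in l,
      (∀ y ∈ V, ‖J s y‖ ≤ M) ∧ ∀ y ∈ V, ∀ y' ∈ V, ‖J s y - J s y'‖ ≤ η := by
  obtain ⟨L, hL⟩ := hJ
  have := hL (Metric.ball_mem_nhds L (half_pos hη))
  obtain ⟨U, hU, V, hV, hUV⟩ := mem_prod_iff.1 this
  refine ⟨V, hV, ‖L‖ + η / 2, ?_⟩
  filter_upwards [hU] with s hs
  have hb : ∀ y ∈ V, ‖J s y - L‖ < η / 2 := fun y hy => by
    have := hUV (show (s, y) ∈ U ×ˢ V from ⟨hs, hy⟩)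
    simpa [dist_eq_norm] using this
  refine ⟨fun y hy => ?_, fun y hy y' hy' => ?_⟩
  · have := norm_add_le (J s y - L) L
    rw [sub_add_cancel] at this
    linarith [hb y hy]
  · have := norm_sub_le (J s y - L) (J s y' - L)
    rw [sub_sub_sub_cancel_right] at this
    linarith [hb y hy, hb y' hy']

theorem IsExceptionalSet.exists_nhds_bound {f : ℝ → E → E} {t₀ : ℝ} {D : Set ℝ}
    (hD : IsExceptionalSet f t₀ D) {t : ℝ} (ht : t₀ ≤ t) (x : E) {η : ℝ} (hη : 0 < η) :
    ∃ V ∈ 𝓝 x, ∃ M, ∀ᶠ s in 𝓝[Ici t₀ \ D] t,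
      (∀ y ∈ V, ‖fderiv ℝ (f s) y‖ ≤ M) ∧
        ∀ y ∈ V, ∀ y' ∈ V, ‖fderiv ℝ (f s) y - fderiv ℝ (f s) y'‖ ≤ η := by
  by_cases htD : t ∈ D
  · obtain ⟨V, hV, M, h⟩ := exists_nhds_bound_of_tendsto
      (J := fun t x => fderiv ℝ (f t) x) (hD.tendsto_right t htD ht x) hη
    have hne : ∀ s ∈ Ici t₀ \ D, s ≠ t := fun s hs he => hs.2 (he ▸ htD)
    rcases ht.eq_or_lt with rfl | hlt
    · refine ⟨V, hV, M, h.filter_mono (nhdsWithin_mono _ fun s hs => ?_)⟩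
      exact lt_of_le_of_ne hs.1 (hne s hs).symm
    · obtain ⟨V', hV', M', h'⟩ := exists_nhds_bound_of_tendsto
        (J := fun t x => fderiv ℝ (f t) x) (hD.tendsto_left t htD hlt x) hη
      refine ⟨V ∩ V', inter_mem hV hV', max M M', ?_⟩
      have hle : 𝓝[Ici t₀ \ D] t ≤ 𝓝[>] t ⊔ 𝓝[<] t := by
        rw [← nhdsWithin_union]
        exact nhdsWithin_mono _ fun s hs => (lt_or_gt_of_ne (hne s hs).symm).imp id id
      refine Eventually.filter_mono hle (eventually_sup.2 ⟨?_, ?_⟩)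
      · filter_upwards [h] with s hs
        exact ⟨fun y hy => (hs.1 y hy.1).trans (le_max_left _ _),
          fun y hy y' hy' => hs.2 y hy.1 y' hy'.1⟩
      · filter_upwards [h'] with s hs
        exact ⟨fun y hy => (hs.1 y hy.2).trans (le_max_right _ _),
          fun y hy y' hy' => hs.2 y hy.2 y' hy'.2⟩
  · refine exists_nhds_bound_of_tendsto (J := fun t x => fderiv ℝ (f t) x)
      ⟨fderiv ℝ (f t) x, ?_⟩ hη
    have := hD.continuousOn_fderiv (t, x) ⟨⟨ht, htD⟩, mem_univ _⟩
    rwa [ContinuousWithinAt, nhdsWithin_prod_eq, nhdsWithin_univ] at this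

/-- Compactness of `Icc a b ×ˢ Z` makes the local bounds uniform. The point `y` may leave `Z`, which
allows comparison with trajectories that are merely near `Z`. One-sided limits serve as continuity
at exceptional times. -/
theorem IsExceptionalSet.exists_bound {f : ℝ → E → E} {t₀ : ℝ} {D : Set ℝ}
    (hD : IsExceptionalSet f t₀ D) {a : ℝ} (ha : t₀ ≤ a) (b : ℝ) {Z : Set E} (hZ : IsCompact Z)
    {η : ℝ} (hη : 0 < η) :
    ∃ ρ > 0, ∃ M, ∀ t ∈ Icc a b, t ∉ D → ∀ x ∈ Z,
      ‖fderiv ℝ (f t) x‖ ≤ M ∧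
        ∀ y, ‖y - x‖ < ρ → ‖fderiv ℝ (f t) y - fderiv ℝ (f t) x‖ ≤ η := by
  have hc : IsCompact (Icc a b ×ˢ Z) := isCompact_Icc.prod hZ
  have : ∃ ρ > 0, ∃ M, ∀ p ∈ Icc a b ×ˢ Z, t₀ ≤ p.1 → p.1 ∉ D →
      ‖fderiv ℝ (f p.1) p.2‖ ≤ M ∧
        ∀ y, ‖y - p.2‖ < ρ → ‖fderiv ℝ (f p.1) y - fderiv ℝ (f p.1) p.2‖ ≤ η := by
    -- The property passes to subsets and finite unions, so it only has to hold near each point.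
    refine hc.induction_on (p := fun A => ∃ ρ > (0 : ℝ), ∃ M, ∀ p ∈ A, t₀ ≤ p.1 → p.1 ∉ D →
      ‖fderiv ℝ (f p.1) p.2‖ ≤ M ∧
        ∀ y, ‖y - p.2‖ < ρ → ‖fderiv ℝ (f p.1) y - fderiv ℝ (f p.1) p.2‖ ≤ η) ?_ ?_ ?_ ?_
    · exact ⟨1, one_pos, 0, by simp⟩
    · rintro A B hAB ⟨ρ, hρ, M, h⟩
      exact ⟨ρ, hρ, M, fun p hp => h p (hAB hp)⟩
    · rintro A B ⟨ρ, hρ, M, h⟩ ⟨ρ', hρ', M', h'⟩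
      refine ⟨min ρ ρ', lt_min hρ hρ', max M M', ?_⟩
      rintro p (hp | hp) h0 hpD
      · have := h p hp h0 hpD
        exact ⟨this.1.trans (le_max_left _ _),
          fun y hy => this.2 y (hy.trans_le (min_le_left _ _))⟩
      · have := h' p hp h0 hpD
        exact ⟨this.1.trans (le_max_right _ _),
          fun y hy => this.2 y (hy.trans_le (min_le_right _ _))⟩
    · rintro ⟨t, x⟩ ⟨ht, hx⟩
      obtain ⟨V, hV, M, h⟩ := hD.exists_nhds_bound (ha.trans ht.1) x hη
      obtain ⟨r, hr, hrV⟩ := Metric.mem_nhds_iff.1 hV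
      rw [eventually_nhdsWithin_iff] at h
      refine ⟨_, mem_nhdsWithin_of_mem_nhds
        (prod_mem_nhds h (Metric.ball_mem_nhds x (half_pos hr))), r / 2, half_pos hr, M, ?_⟩
      rintro ⟨s, y⟩ ⟨hs, hy⟩ h0 hsD
      obtain ⟨h1, h2⟩ := hs ⟨h0, hsD⟩
      have hyV : y ∈ V := hrV (Metric.ball_subset_ball (by linarith) hy)
      refine ⟨h1 y hyV, fun y' hy' => h2 y' (hrV ?_) y hyV⟩
      rw [Metric.mem_ball] at hy ⊢
      rw [← dist_eq_norm] at hy'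
      linarith [dist_triangle y' y x]
  obtain ⟨ρ, hρ, M, h⟩ := this
  exact ⟨ρ, hρ, M, fun t ht htD x hx => h (t, x) ⟨ht, hx⟩ (ha.trans ht.1) htD⟩

end TVEntropy

/-! ### Separation of nearby solutions, uniqueness and continuous dependence -/

namespace TVEntropy

variable {E : Type*} [NormedAddCommGroup E] [NormedSpace ℝ E]

theorem matrixMeasure_le_norm [Nontrivial E] (A : E →L[ℝ] E) : matrixMeasure A ≤ ‖A‖ := by
  refine le_of_tendsto (tendsto_matrixMeasure A) ?_
  filter_upwards [self_mem_nhdsWithin] with t ht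
  have ht' : (0 : ℝ) < t := ht
  rw [div_le_iff₀ ht']
  have := norm_add_le (ContinuousLinearMap.id ℝ E) (t • A)
  rw [ContinuousLinearMap.norm_id, norm_smul, Real.norm_of_nonneg ht'.le] at this
  linarith

/-- By first-order expansion, `g (t + h) = (I + hA) g t + h (g' - A (g t)) + o(h)`. Taking norms,
the first term contributes `(‖I + hA‖ - 1) / h → μ(A)` to the slope and the second at most `η ‖g
t‖`. -/
theorem eventually_slope_norm_lt [Nontrivial E] {g : ℝ → E} {g' : E} {t η r : ℝ} (A : E →L[ℝ] E)
    (hg : HasDerivWithinAt g g' (Ioi t) t) (hA : ‖g' - A (g t)‖ ≤ η * ‖g t‖)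
    (hr : (matrixMeasure A + η) * ‖g t‖ < r) :
    ∀ᶠ s in 𝓝[>] t, (s - t)⁻¹ * (‖g s‖ - ‖g t‖) < r := by
  have hsub : Tendsto (fun s => s - t) (𝓝[>] t) (𝓝[>] 0) := by
    refine tendsto_nhdsWithin_iff.2 ⟨?_, ?_⟩
    · have : Tendsto (fun s => s - t) (𝓝 t) (𝓝 (t - t)) :=
        (continuous_id.sub continuous_const).tendsto t
      rw [sub_self] at this
      exact this.mono_left nhdsWithin_le_nhds
    · filter_upwards [self_mem_nhdsWithin] with s hs using sub_pos.2 (mem_Ioi.1 hs)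
  have h1 := (tendsto_matrixMeasure A).comp hsub
  have h2 : Tendsto (fun s => ‖slope g t s - g'‖) (𝓝[>] t) (𝓝 0) := by
    rw [hasDerivWithinAt_iff_tendsto_slope' (by simp)] at hg
    exact tendsto_iff_norm_sub_tendsto_zero.1 hg
  have h3 := ((h1.mul_const ‖g t‖).add_const (η * ‖g t‖)).add h2
  have h4 : matrixMeasure A * ‖g t‖ + η * ‖g t‖ + 0 < r := by linarith
  filter_upwards [h3.eventually_lt_const h4, self_mem_nhdsWithin] with s hs hst
  refine lt_of_le_of_lt ?_ hs
  have hpos : 0 < s - t := sub_pos.2 hst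
  simp only [Function.comp]
  rw [inv_mul_le_iff₀ hpos]
  have e : g s = (ContinuousLinearMap.id ℝ E + (s - t) • A) (g t) + (s - t) • (g' - A (g t))
      + (s - t) • (slope g t s - g') := by
    have : (s - t) • slope g t s = g s - g t := sub_smul_slope g t s
    simp only [smul_sub, this, add_apply, smul_apply,
      ContinuousLinearMap.id_apply]
    abel
  have h5 : ‖g s‖ ≤ ‖ContinuousLinearMap.id ℝ E + (s - t) • A‖ * ‖g t‖
      + (s - t) * (η * ‖g t‖) + (s - t) * ‖slope g t s - g'‖ := by
    rw [e]
    refine (norm_add₃_le).trans ?_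
    rw [norm_smul, norm_smul, Real.norm_of_nonneg hpos.le]
    gcongr
    exact ContinuousLinearMap.le_opNorm _ _
  have h6 : (s - t) * ((‖ContinuousLinearMap.id ℝ E + (s - t) • A‖ - 1) / (s - t) * ‖g t‖
      + η * ‖g t‖ + ‖slope g t s - g'‖) = ‖ContinuousLinearMap.id ℝ E + (s - t) • A‖ * ‖g t‖
      + (s - t) * (η * ‖g t‖) + (s - t) * ‖slope g t s - g'‖ - ‖g t‖ := by
    field_simp
    ring
  rw [h6]
  linarith

variable {f : ℝ → E → E} {t₀ : ℝ} {D : Set ℝ}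

theorem IsSolution.apply_initial {a : ℝ} {x : E} {γ : ℝ → E} (h : IsSolution f a x γ) :
    γ a = x := by
  simpa using h.eq_integral a le_rfl

theorem IsSolution.restrict {a a' : ℝ} {x : E} {γ : ℝ → E} (h : IsSolution f a x γ)
    (ha : a ≤ a') : IsSolution f a' (γ a') γ where
  continuousOn := h.continuousOn.mono (Ici_subset_Ici.2 ha)
  intervalIntegrable t ht :=
    (h.intervalIntegrable a' ha).symm.trans (h.intervalIntegrable t (ha.trans ht))
  eq_integral t ht := by
    rw [h.eq_integral t (ha.trans ht), h.eq_integral a' ha, add_assoc,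
      intervalIntegral.integral_add_adjacent_intervals (h.intervalIntegrable a' ha)]
    exact (h.intervalIntegrable a' ha).symm.trans (h.intervalIntegrable t (ha.trans ht))

theorem IsExceptionalSet.eventually_notMem (hD : IsExceptionalSet f t₀ D) {t : ℝ} (ht : t₀ ≤ t) :
    ∀ᶠ s in 𝓝[>] t, s ∈ Ici t₀ \ D := by
  have hc : IsClosed ((D ∩ Icc t₀ (t + 1)) \ {t}) :=
    ((hD.finite (t + 1)).subset sdiff_subset).isClosed
  have : ((D ∩ Icc t₀ (t + 1)) \ {t})ᶜ ∈ 𝓝 t := hc.isOpen_compl.mem_nhds (by simp)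
  filter_upwards [nhdsWithin_le_nhds this, Ioo_mem_nhdsGT (lt_add_one t)] with s hs hst
  exact ⟨ht.trans hst.1.le, fun hsD => hs ⟨⟨hsD, ht.trans hst.1.le, hst.2.le⟩, hst.1.ne'⟩⟩

/-- Local finiteness of `D` keeps times just after `t` out of `D`, so the integrand is
right-continuous at `t` and the one-sided fundamental theorem of calculus applies. -/
theorem IsSolution.hasDerivWithinAt [CompleteSpace E] (hD : IsExceptionalSet f t₀ D) {a : ℝ}
    {x : E} {γ : ℝ → E} (h : IsSolution f a x γ) (ha : t₀ ≤ a) {t : ℝ} (hat : a ≤ t)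
    (htD : t ∉ D) : HasDerivWithinAt γ (f t (γ t)) (Ioi t) t := by
  have hγ : ContinuousWithinAt γ (Ioi t) t :=
    (h.continuousOn t hat).mono fun s hs => hat.trans (le_of_lt hs)
  have hc : ContinuousWithinAt (fun s => f s (γ s)) (Ioi t) t := by
    have h1 := hD.continuousOn (t, γ t) ⟨⟨ha.trans hat, htD⟩, mem_univ _⟩
    have h2 : Tendsto (fun s => (s, γ s)) (𝓝[>] t) (𝓝[(Ici t₀ \ D) ×ˢ univ] (t, γ t)) := by
      refine tendsto_nhdsWithin_iff.2 ⟨?_, ?_⟩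
      · exact (tendsto_id.mono_left nhdsWithin_le_nhds).prodMk_nhds hγ
      · filter_upwards [hD.eventually_notMem (ha.trans hat)] with s hs using ⟨hs, mem_univ _⟩
    exact h1.tendsto.comp h2
  have hint := (h.restrict hat).intervalIntegrable (t + 1) (by linarith)
  have hm : StronglyMeasurableAtFilter (fun s => f s (γ s)) (𝓝[>] t) :=
    ⟨Ioc t (t + 1), Ioc_mem_nhdsGT (lt_add_one t), hint.aestronglyMeasurable⟩
  have hd := intervalIntegral.integral_hasDerivWithinAt_right (h.intervalIntegrable t hat)
    (s := Ici t) (t := Ioi t) hm hc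
  have hd' := ((hd.const_add x).mono Ioi_subset_Ici_self)
  refine hd'.congr_of_eventuallyEq ?_ (h.eq_integral t hat)
  filter_upwards [self_mem_nhdsWithin] with s hs
  exact h.eq_integral s (hat.trans (le_of_lt hs))

/-- Two solutions that start close enough to each other separate at most at any rate above the
matrix measure of the Jacobian along the first one, on a bounded time interval. -/
theorem IsExceptionalSet.exists_norm_sub_le [CompleteSpace E] [Nontrivial E]
    (hD : IsExceptionalSet f t₀ D)
    {a : ℝ} (ha : t₀ ≤ a) (b : ℝ) {Z : Set E} (hZ : IsCompact Z) {c κ : ℝ} (hκ : 0 ≤ κ)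
    (hcκ : c < κ) :
    ∃ δ > 0, ∀ x y : E, ∀ γ₁ γ₂ : ℝ → E, IsSolution f a x γ₁ → IsSolution f a y γ₂ →
      (∀ t ∈ Icc a b, γ₁ t ∈ Z) →
      (∀ t ∈ Icc a b, t ∉ D → matrixMeasure (fderiv ℝ (f t) (γ₁ t)) ≤ c) → ‖y - x‖ < δ →
      ∀ t ∈ Icc a b, ‖γ₂ t - γ₁ t‖ ≤ ‖y - x‖ * Real.exp (κ * (t - a)) := by
  obtain ⟨ρ, hρ, M, hM⟩ := hD.exists_bound ha b hZ (sub_pos.2 hcκ)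
  -- With this `δ`, growth at rate `κ` up to time `b` cannot carry the difference out of the radius
  -- `ρ` where the Jacobian oscillates by at most `κ - c`.
  refine ⟨ρ * Real.exp (-(κ * (b - a))), by positivity, ?_⟩
  intro x y γ₁ γ₂ h₁ h₂ hZγ hμ hxy
  have hgrow := le_mul_exp_of_frequently_slope_lt (φ := fun t => ‖γ₂ t - γ₁ t‖) (D := D) (a := a)
    (b := b) (κ := κ) (ρ := ρ) ?_ ?_ hκ (norm_nonneg _) ?_ ?_
  · simpa only [h₁.apply_initial, h₂.apply_initial] using hgrow
  · exact ((h₂.continuousOn.sub h₁.continuousOn).norm).mono Icc_subset_Ici_self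
  · exact (hD.finite b).subset (inter_subset_inter_right _ (Icc_subset_Icc_left ha))
  · simp only [h₁.apply_initial, h₂.apply_initial]
    have := mul_lt_mul_of_pos_right hxy (Real.exp_pos (κ * (b - a)))
    rwa [mul_assoc, ← Real.exp_add, neg_add_cancel, Real.exp_zero, mul_one] at this
  · intro t ht htD htρ r hr
    have htI : t ∈ Icc a b := ⟨ht.1, ht.2.le⟩
    obtain ⟨-, hosc⟩ := hM t htI htD (γ₁ t) (hZγ t htI)
    refine (eventually_slope_norm_lt (g := fun t => γ₂ t - γ₁ t) (η := κ - c)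
      (fderiv ℝ (f t) (γ₁ t))
      ((h₂.hasDerivWithinAt hD ha ht.1 htD).sub (h₁.hasDerivWithinAt hD ha ht.1 htD))
      ?_ ?_).frequently
    -- The mean value inequality on the ball of radius `ρ` bounds the linearization error by `(κ -
    -- c)‖g t‖`.
    · refine Convex.norm_image_sub_le_of_norm_fderiv_le' (s := Metric.ball (γ₁ t) ρ)
        (fun z _ => ((hD.contDiff t (ha.trans ht.1)).differentiable one_ne_zero) z) ?_
        (convex_ball _ _) (Metric.mem_ball_self hρ) ?_
      · intro z hz
        exact hosc z (by simpa [dist_eq_norm] using hz)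
      · simpa [dist_eq_norm] using htρ
    · refine lt_of_le_of_lt ?_ hr
      exact mul_le_mul_of_nonneg_right (by linarith [hμ t htI htD]) (norm_nonneg _)

/-- Solutions that start close enough to a family of solutions with values in a compact set stay
close on a bounded time interval. -/
theorem IsExceptionalSet.exists_rate_norm_sub_le [CompleteSpace E] [Nontrivial E]
    (hD : IsExceptionalSet f t₀ D) {a : ℝ} (ha : t₀ ≤ a) (b : ℝ) {Z : Set E} (hZ : IsCompact Z) :
    ∃ κ, 0 ≤ κ ∧ ∃ δ > 0, ∀ x y : E, ∀ γ₁ γ₂ : ℝ → E, IsSolution f a x γ₁ → IsSolution f a y γ₂ →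
      (∀ t ∈ Icc a b, γ₁ t ∈ Z) → ‖y - x‖ < δ →
      ∀ t ∈ Icc a b, ‖γ₂ t - γ₁ t‖ ≤ ‖y - x‖ * Real.exp (κ * (t - a)) := by
  obtain ⟨ρ, hρ, M, hM⟩ := hD.exists_bound ha b hZ one_pos
  obtain ⟨δ, hδ, h⟩ := hD.exists_norm_sub_le ha b hZ (c := max M 0) (κ := max M 0 + 1)
    (by positivity) (by linarith)
  refine ⟨max M 0 + 1, by positivity, δ, hδ, fun x y γ₁ γ₂ h₁ h₂ hZγ hxy => ?_⟩
  refine h x y γ₁ γ₂ h₁ h₂ hZγ (fun t ht htD => ?_) hxy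
  exact (matrixMeasure_le_norm _).trans ((hM t ht htD _ (hZγ t ht)).1.trans (le_max_left _ _))

/-- This is the separation estimate for coinciding initial states. -/
theorem IsExceptionalSet.solution_unique [CompleteSpace E] [Nontrivial E]
    (hD : IsExceptionalSet f t₀ D) {a : ℝ} (ha : t₀ ≤ a) {x : E} {γ₁ γ₂ : ℝ → E}
    (h₁ : IsSolution f a x γ₁) (h₂ : IsSolution f a x γ₂) {t : ℝ} (ht : a ≤ t) :
    γ₂ t = γ₁ t := by
  have hZ : IsCompact (γ₁ '' Icc a t) :=
    isCompact_Icc.image_of_continuousOn (h₁.continuousOn.mono Icc_subset_Ici_self)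
  obtain ⟨κ, -, δ, hδ, h⟩ := hD.exists_rate_norm_sub_le ha t hZ
  have := h x x γ₁ γ₂ h₁ h₂ (fun s hs => mem_image_of_mem _ hs) (by simpa using hδ) t ⟨ht, le_rfl⟩
  rw [sub_self, norm_zero, zero_mul, norm_le_zero_iff, sub_eq_zero] at this
  exact this

theorem ForwardComplete.isSolution_sol (hfc : ForwardComplete f t₀) {a : ℝ} (ha : t₀ ≤ a) (x : E) :
    IsSolution f a x (fun t => sol f t a x) := by
  have h := hfc a ha x
  have e : (fun t => sol f t a x) = h.choose := by
    ext t
    rw [sol, dif_pos h]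
  rw [e]
  exact h.choose_spec

theorem sol_sol [CompleteSpace E] [Nontrivial E] (hD : IsExceptionalSet f t₀ D)
    (hfc : ForwardComplete f t₀)
    {a a' t : ℝ} (ha : t₀ ≤ a) (haa' : a ≤ a') (ht : a' ≤ t) (x : E) :
    sol f t a' (sol f a' a x) = sol f t a x :=
  hD.solution_unique (ha.trans haa') ((hfc.isSolution_sol ha x).restrict haa')
    (hfc.isSolution_sol (ha.trans haa') _) ht

/-- The separation estimate is uniform in time, so joint continuity follows from it and from
continuity of the single trajectory through `x`. -/
theorem continuousOn_sol [CompleteSpace E] [Nontrivial E] (hD : IsExceptionalSet f t₀ D)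
    (hfc : ForwardComplete f t₀) {a : ℝ} (ha : t₀ ≤ a) (b : ℝ) :
    ContinuousOn (fun p : ℝ × E => sol f p.1 a p.2) (Icc a b ×ˢ univ) := by
  rintro ⟨t, x⟩ ⟨ht, -⟩
  have hx := hfc.isSolution_sol ha x
  have hc : ContinuousOn (fun t => sol f t a x) (Icc a b) :=
    hx.continuousOn.mono Icc_subset_Ici_self
  obtain ⟨κ, hκ, δ, hδ, h⟩ := hD.exists_rate_norm_sub_le ha b (isCompact_Icc.image_of_continuousOn hc)
  have hfst : Tendsto (fun p : ℝ × E => p.1) (𝓝[Icc a b ×ˢ univ] (t, x)) (𝓝[Icc a b] t) := by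
    rw [nhdsWithin_prod_eq]; exact tendsto_fst
  have hsnd : Tendsto (fun p : ℝ × E => p.2) (𝓝[Icc a b ×ˢ univ] (t, x)) (𝓝 x) :=
    (continuous_snd.tendsto (t, x)).mono_left nhdsWithin_le_nhds
  have h1 : Tendsto (fun p : ℝ × E => ‖p.2 - x‖) (𝓝[Icc a b ×ˢ univ] (t, x)) (𝓝 0) :=
    tendsto_iff_norm_sub_tendsto_zero.1 hsnd
  have h2 : Tendsto (fun p : ℝ × E => ‖sol f p.1 a x - sol f t a x‖)
      (𝓝[Icc a b ×ˢ univ] (t, x)) (𝓝 0) :=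
    tendsto_iff_norm_sub_tendsto_zero.1 ((hc t ht).tendsto.comp hfst)
  refine tendsto_iff_norm_sub_tendsto_zero.2 ?_
  have h3 := (h1.mul_const (Real.exp (κ * (b - a)))).add h2
  rw [zero_mul, zero_add] at h3
  refine squeeze_zero' (Eventually.of_forall fun _ => norm_nonneg _) ?_ h3
  filter_upwards [h1.eventually_lt_const hδ, self_mem_nhdsWithin] with p hp hpI
  have h4 := h x p.2 _ _ hx (hfc.isSolution_sol ha p.2) (fun s hs => mem_image_of_mem _ hs) hp
    p.1 hpI.1
  have h5 := norm_add_le (sol f p.1 a p.2 - sol f p.1 a x) (sol f p.1 a x - sol f t a x)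
  rw [sub_add_sub_cancel] at h5
  refine h5.trans (add_le_add (h4.trans ?_) le_rfl)
  have := hpI.1.2
  gcongr

theorem isCompact_image_sol [CompleteSpace E] [Nontrivial E] (hD : IsExceptionalSet f t₀ D)
    (hfc : ForwardComplete f t₀) {a : ℝ} (ha : t₀ ≤ a) (b : ℝ) {Q : Set E} (hQ : IsCompact Q) :
    IsCompact ((fun p : ℝ × E => sol f p.1 a p.2) '' (Icc a b ×ˢ Q)) :=
  (isCompact_Icc.prod hQ).image_of_continuousOn
    ((continuousOn_sol hD hfc ha b).mono (prod_mono_right (subset_univ _)))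

end TVEntropy

/-! ### From local to global Lipschitz estimates for the flow -/

namespace TVEntropy

variable {E : Type*} [NormedAddCommGroup E] [NormedSpace ℝ E]

/-- Cut the segment into `N` equal pieces shorter than `δ` and sum. The scale `δ` does not enter the
conclusion, so it may depend on the time horizon without loss. -/
theorem norm_sub_le_of_locally_on_segment {g : E → E} {v w : E} {L δ : ℝ} (hδ : 0 < δ)
    (h : ∀ p ∈ segment ℝ v w, ∀ q ∈ segment ℝ v w, ‖q - p‖ < δ → ‖g q - g p‖ ≤ L * ‖q - p‖) :
    ‖g w - g v‖ ≤ L * ‖w - v‖ := by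
  obtain ⟨N, hN⟩ := exists_nat_gt (‖w - v‖ / δ)
  have hN0 : (0 : ℝ) < N := lt_of_le_of_lt (by positivity) hN
  let p : ℕ → E := fun k => AffineMap.lineMap v w ((k : ℝ) / N)
  have hp : ∀ k ≤ N, p k ∈ segment ℝ v w := fun k hk => by
    rw [segment_eq_image_lineMap]
    exact mem_image_of_mem _ ⟨by positivity, (div_le_one hN0).2 (by exact_mod_cast hk)⟩
  have hstep : ∀ k, ‖p (k + 1) - p k‖ = ‖w - v‖ / N := fun k => by
    have : p (k + 1) - p k = (1 / (N : ℝ)) • (w - v) := by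
      simp only [p, AffineMap.lineMap_apply_module']
      rw [add_sub_add_right_eq_sub, ← sub_smul]
      push_cast
      ring_nf
    rw [this, norm_smul, Real.norm_of_nonneg (by positivity)]
    ring
  have hlt : ‖w - v‖ / N < δ := by
    rw [div_lt_iff₀ hN0]
    rwa [div_lt_iff₀ hδ, mul_comm] at hN
  have h0 : p 0 = v := by simp [p]
  have h1 : p N = w := by simp [p, div_self hN0.ne']
  have hsum : g w - g v = ∑ k ∈ Finset.range N, (g (p (k + 1)) - g (p k)) := by
    rw [Finset.sum_range_sub (fun k => g (p k)), h0, h1]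
  rw [hsum]
  refine (norm_sum_le_of_le _ (fun k hk => ?_)).trans_eq
    (b := ∑ k ∈ Finset.range N, L * (‖w - v‖ / N)) ?_
  · have hk := Finset.mem_range.1 hk
    rw [← hstep k]
    exact h _ (hp k hk.le) _ (hp (k + 1) hk) (by rwa [hstep])
  · rw [Finset.sum_const, Finset.card_range, nsmul_eq_mul]
    field_simp

variable {f : ℝ → E → E} {t₀ : ℝ} {D : Set ℝ} [FiniteDimensional ℝ E] [Nontrivial E]

theorem exists_lipschitz_sol (hD : IsExceptionalSet f t₀ D) (hfc : ForwardComplete f t₀) {a : ℝ}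
    (ha : t₀ ≤ a) (b : ℝ) {Q : Set E} (hQ : Bornology.IsBounded Q) :
    ∃ L, 1 ≤ L ∧ ∀ x ∈ convexHull ℝ Q, ∀ y ∈ convexHull ℝ Q, ∀ t ∈ Icc a b,
      ‖sol f t a y - sol f t a x‖ ≤ L * ‖y - x‖ := by
  have := FiniteDimensional.complete ℝ E
  have := FiniteDimensional.proper_real E
  obtain ⟨R, hR⟩ := hQ.subset_closedBall 0
  -- A closed ball containing `Q` is convex, so it also holds all segments between points of the
  -- hull.
  have hsub : convexHull ℝ Q ⊆ Metric.closedBall 0 R := convexHull_min hR (convex_closedBall _ _)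
  have hZ := isCompact_image_sol hD hfc ha b (isCompact_closedBall (0 : E) R)
  obtain ⟨κ, hκ, δ, hδ, h⟩ := hD.exists_rate_norm_sub_le ha b hZ
  refine ⟨max 1 (Real.exp (κ * (b - a))), le_max_left _ _, fun x hx y hy t ht => ?_⟩
  refine norm_sub_le_of_locally_on_segment (g := sol f t a) hδ fun p hp q hq hpq => ?_
  have hpR : p ∈ Metric.closedBall (0 : E) R :=
    (convex_closedBall _ _).segment_subset (hsub hx) (hsub hy) hp
  refine (h p q _ _ (hfc.isSolution_sol ha p) (hfc.isSolution_sol ha q)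
    (fun s hs => ⟨(s, p), ⟨hs, hpR⟩, rfl⟩) hpq t ht).trans ?_
  rw [mul_comm]
  refine mul_le_mul_of_nonneg_right (le_trans ?_ (le_max_right _ _)) (norm_nonneg _)
  have := ht.2
  gcongr

/-- If the matrix measure of the Jacobian along trajectories issued from the convex hull of a
reachable set is eventually at most `c`, then trajectories issued from `K` separate at most at any
nonnegative exponential rate above `c`. -/
theorem exists_norm_sol_sub_le (hD : IsExceptionalSet f t₀ D) (hfc : ForwardComplete f t₀)
    {K : Set E} (hK : IsCompact K) {t₁ t₂ c κ : ℝ} (h₁ : t₀ ≤ t₁) (h₂ : t₁ ≤ t₂) (hκ : 0 ≤ κ)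
    (hcκ : c < κ)
    (hμ : ∀ t, t₂ ≤ t → ∀ v ∈ convexHull ℝ ((fun x => sol f t₁ t₀ x) '' K),
      matrixMeasure (fderiv ℝ (f t) (sol f t t₁ v)) ≤ c) :
    ∃ L, 0 < L ∧ ∀ x ∈ K, ∀ y ∈ K, ∀ t, t₀ ≤ t →
      ‖sol f t t₀ y - sol f t t₀ x‖ ≤ L * Real.exp (κ * (t - t₀)) * ‖y - x‖ := by
  have := FiniteDimensional.complete ℝ E
  set Q := (fun x => sol f t₁ t₀ x) '' K with hQdef
  have hQ : IsCompact Q := by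
    refine hK.image_of_continuousOn ?_
    have := continuousOn_sol hD hfc le_rfl t₁
    exact this.comp (f := fun x : E => (t₁, x)) (by fun_prop)
      (fun x _ => ⟨⟨h₁, le_rfl⟩, mem_univ _⟩)
  obtain ⟨L₀, hL₀, hlip₀⟩ := exists_lipschitz_sol hD hfc le_rfl t₁ hK.isBounded
  obtain ⟨L₁, hL₁, hlip₁⟩ := exists_lipschitz_sol hD hfc h₁ t₂ hQ.isBounded
  have hlate : ∀ v ∈ convexHull ℝ Q, ∀ w ∈ convexHull ℝ Q, ∀ t, t₂ ≤ t →
      ‖sol f t t₁ w - sol f t t₁ v‖ ≤ L₁ * Real.exp (κ * (t - t₂)) * ‖w - v‖ := by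
    intro v hv w hw t ht
    have hseg : segment ℝ v w ⊆ convexHull ℝ Q := (convex_convexHull ℝ Q).segment_subset hv hw
    have hsegc : IsCompact (segment ℝ v w) := by
      rw [segment_eq_image_lineMap]
      exact isCompact_Icc.image (by fun_prop)
    have hZ := isCompact_image_sol hD hfc h₁ t hsegc
    obtain ⟨δ, hδ, h⟩ := hD.exists_norm_sub_le (h₁.trans h₂) t hZ hκ hcκ
    have hL₁' : 0 < L₁ := by linarith
    -- The radius `δ` concerns states at time `t₂`; dividing by the Lipschitz constant `L₁` from
    -- `t₁` to `t₂` transports it to time `t₁`, where the segment lies in the hull.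
    refine norm_sub_le_of_locally_on_segment (g := sol f t t₁) (div_pos hδ hL₁')
      fun p hp q hq hpq => ?_
    have hpq₂ := hlip₁ p (hseg hp) q (hseg hq) t₂ ⟨h₂, le_rfl⟩
    have hlt : ‖sol f t₂ t₁ q - sol f t₂ t₁ p‖ < δ := by
      rw [lt_div_iff₀ hL₁', mul_comm] at hpq
      exact hpq₂.trans_lt hpq
    have := h _ _ _ _ ((hfc.isSolution_sol h₁ p).restrict h₂)
      ((hfc.isSolution_sol h₁ q).restrict h₂)
      (fun s hs => ⟨(s, p), ⟨⟨h₂.trans hs.1, hs.2⟩, hp⟩, rfl⟩)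
      (fun s hs _ => hμ s hs.1 p (hseg hp)) hlt t ⟨ht, le_rfl⟩
    refine this.trans ?_
    rw [mul_right_comm]
    gcongr
  have hcL : 1 ≤ L₀ * L₁ := one_le_mul_of_one_le_of_one_le hL₀ hL₁
  refine ⟨L₀ * L₁, by positivity, fun x hx y hy t ht => ?_⟩
  have hexp : 1 ≤ Real.exp (κ * (t - t₀)) :=
    Real.one_le_exp (mul_nonneg hκ (sub_nonneg.2 ht))
  have hxy := norm_nonneg (y - x)
  have h₀' : ∀ s ∈ Icc t₀ t₁, ‖sol f s t₀ y - sol f s t₀ x‖ ≤ L₀ * ‖y - x‖ :=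
    hlip₀ x (subset_convexHull ℝ K hx) y (subset_convexHull ℝ K hy)
  rcases le_total t t₁ with htt | htt
  · refine (h₀' t ⟨ht, htt⟩).trans ?_
    gcongr
    rw [mul_assoc]
    exact le_mul_of_one_le_right (by linarith) (one_le_mul_of_one_le_of_one_le hL₁ hexp)
  have hxQ : sol f t₁ t₀ x ∈ convexHull ℝ Q := subset_convexHull ℝ Q (mem_image_of_mem _ hx)
  have hyQ : sol f t₁ t₀ y ∈ convexHull ℝ Q := subset_convexHull ℝ Q (mem_image_of_mem _ hy)
  have h₁' := h₀' t₁ ⟨h₁, le_rfl⟩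
  rw [← sol_sol hD hfc le_rfl h₁ htt x, ← sol_sol hD hfc le_rfl h₁ htt y]
  rcases le_total t t₂ with htt' | htt'
  · refine (hlip₁ _ hxQ _ hyQ t ⟨htt, htt'⟩).trans ?_
    calc L₁ * ‖sol f t₁ t₀ y - sol f t₁ t₀ x‖ ≤ L₁ * (L₀ * ‖y - x‖) := by gcongr
      _ = L₀ * L₁ * 1 * ‖y - x‖ := by ring
      _ ≤ _ := by gcongr
  · refine (hlate _ hxQ _ hyQ t htt').trans ?_
    calc L₁ * Real.exp (κ * (t - t₂)) * ‖sol f t₁ t₀ y - sol f t₁ t₀ x‖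
        ≤ L₁ * Real.exp (κ * (t - t₂)) * (L₀ * ‖y - x‖) := by gcongr
      _ = L₀ * L₁ * Real.exp (κ * (t - t₂)) * ‖y - x‖ := by ring
      _ ≤ _ := by
        have := h₁.trans h₂
        gcongr

end TVEntropy

/-! ### Counting spanning sets and bounding the entropy -/

namespace TVEntropy

variable {E : Type*} [NormedAddCommGroup E] [NormedSpace ℝ E]

theorem entropy_nonpos_of_subsingleton [Subsingleton E] (f : ℝ → E → E) (t₀ : ℝ) (K : Set E) :
    entropy f t₀ K ≤ 0 := by
  refine iSup₂_le fun ε hε => ?_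
  have h : ∀ᶠ T : ℝ in atTop,
      ENNReal.log (spanCard f t₀ ε T K : ENNReal) / (T : EReal) ≤ 0 := by
    filter_upwards [eventually_ge_atTop (0 : ℝ)] with T hT
    -- The set `K` spans itself. It may be empty, in which case the logarithm is `⊥`.
    have hspan : spanCard f t₀ ε T K ≤ 1 := by
      refine (iInf₂_le K ⟨Subset.rfl, fun x hx => ?_⟩).trans
        (encard_le_one_iff.2 fun a b _ _ => Subsingleton.elim a b)
      refine mem_iUnion₂.2 ⟨x, hx, fun t _ => ?_⟩
      simpa using hε
    have hlog : ENNReal.log (spanCard f t₀ ε T K : ENNReal) ≤ 0 := by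
      rw [← ENNReal.log_one]
      exact ENNReal.log_monotone (by exact_mod_cast hspan)
    have := EReal.div_le_div_right_of_nonneg (a := ENNReal.log (spanCard f t₀ ε T K : ENNReal))
      (b := 0) (c := (T : EReal)) (by exact_mod_cast hT) hlog
    simpa using this
  exact limsup_le_of_le (h := h)

variable [FiniteDimensional ℝ E]

open MeasureTheory Module in
-- The balls of radius `r / 2` around the points are disjoint and lie in a ball of radius `R + r /
-- 2`; compare Haar volumes.
theorem card_mul_pow_le_of_separated {s : Finset E} {R r : ℝ} (hr : 0 < r)
    (hs : ∀ x ∈ s, ‖x‖ ≤ R) (hR : 0 ≤ R) (hsep : ∀ x ∈ s, ∀ y ∈ s, x ≠ y → r ≤ dist x y) :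
    (s.card : ℝ) * (r / 2) ^ finrank ℝ E ≤ (R + r / 2) ^ finrank ℝ E := by
  borelize E
  let μ : Measure E := Measure.addHaar
  have hr2 : 0 < r / 2 := half_pos hr
  have hR2 : 0 < R + r / 2 := by positivity
  have hdisj : (s : Set E).Pairwise (Function.onFun Disjoint fun c => Metric.ball c (r / 2)) := by
    intro c hc d hd hcd
    exact Metric.ball_disjoint_ball (by linarith [hsep c hc d hd hcd])
  have hsub : (⋃ c ∈ s, Metric.ball c (r / 2)) ⊆ Metric.ball (0 : E) (R + r / 2) := by
    refine iUnion₂_subset fun x hx => Metric.ball_subset_ball' ?_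
    rw [dist_zero_right]
    linarith [hs x hx]
  have hI : (s.card : ENNReal) * ENNReal.ofReal ((r / 2) ^ finrank ℝ E) * μ (Metric.ball 0 1) ≤
      ENNReal.ofReal ((R + r / 2) ^ finrank ℝ E) * μ (Metric.ball 0 1) := by
    calc _ = μ (⋃ c ∈ s, Metric.ball c (r / 2)) := by
          rw [measure_biUnion_finset hdisj fun c _ => measurableSet_ball]
          simp only [μ.addHaar_ball_of_pos _ hr2, Finset.sum_const, nsmul_eq_mul, mul_assoc]
      _ ≤ μ (Metric.ball (0 : E) (R + r / 2)) := measure_mono hsub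
      _ = _ := by rw [μ.addHaar_ball_of_pos _ hR2]
  have hJ := (ENNReal.mul_le_mul_iff_left (Metric.measure_ball_pos μ _ zero_lt_one).ne'
    measure_ball_lt_top.ne).1 hI
  have := ENNReal.toReal_le_of_le_ofReal (by positivity) hJ
  rwa [ENNReal.toReal_mul, ENNReal.toReal_natCast, ENNReal.toReal_ofReal (by positivity)] at this

open Module in
theorem exists_finite_cover_encard_le {K : Set E} (hK : Bornology.IsBounded K) :
    ∃ C : ℝ, 0 < C ∧ ∀ r : ℝ, 0 < r → r ≤ 1 → ∃ F ⊆ K,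
      (F.encard : ENNReal) ≤ ENNReal.ofReal (C * r⁻¹ ^ finrank ℝ E) ∧
        ∀ x ∈ K, ∃ y ∈ F, dist x y ≤ r := by
  obtain ⟨R, hR⟩ := hK.subset_closedBall 0
  set R' := max R 0
  -- For `r ≤ 1`, the ratio `(R' + r / 2) / (r / 2)` of radii is at most `2 (R' + 1) / r`.
  refine ⟨(2 * (R' + 1)) ^ finrank ℝ E, by positivity, fun r hr hr1 => ?_⟩
  set B : ℝ := (2 * (R' + 1)) ^ finrank ℝ E * r⁻¹ ^ finrank ℝ E with hB
  have hcard : ∀ s : Finset E, (s : Set E) ⊆ K →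
      (∀ x ∈ s, ∀ y ∈ s, x ≠ y → r ≤ dist x y) → (s.card : ℝ) ≤ B := by
    intro s hsK hsep
    have h := card_mul_pow_le_of_separated hr (R := R') (fun x hx =>
      (mem_closedBall_zero_iff.1 (hR (hsK hx))).trans (le_max_left _ _)) (le_max_right _ _) hsep
    have h' : (R' + r / 2) ^ finrank ℝ E ≤ (R' + 1) ^ finrank ℝ E := by
      gcongr; linarith
    have e : B = (R' + 1) ^ finrank ℝ E / (r / 2) ^ finrank ℝ E := by
      rw [hB, ← mul_pow, ← div_pow]; congr 1; field_simp
    rw [e, le_div_iff₀ (by positivity)]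
    exact h.trans h'
  have hpack : Metric.packingNumber r.toNNReal K ≤ (⌊B⌋₊ : ℕ∞) := by
    refine iSup_le fun S => iSup₂_le fun hSK hSsep => ?_
    by_contra! hlt
    -- A separated set could a priori be infinite, so the volume bound is applied to a subset with
    -- exactly `⌊B⌋₊ + 1` points.
    obtain ⟨S', hS', hcS'⟩ := exists_subset_encard_eq (Order.add_one_le_of_lt hlt)
    have hfin : S'.Finite := finite_of_encard_eq_coe (k := ⌊B⌋₊ + 1) (by simpa using hcS')
    have h := hcard hfin.toFinset (by simpa using hS'.trans hSK) ?_
    · have h2 : hfin.toFinset.card = ⌊B⌋₊ + 1 := by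
        rw [hfin.encard_eq_coe_toFinset_card] at hcS'
        exact_mod_cast hcS'
      rw [h2] at h
      push_cast at h
      linarith [Nat.lt_floor_add_one B]
    · intro x hx y hy hxy
      have := hSsep (hS' (hfin.mem_toFinset.1 hx)) (hS' (hfin.mem_toFinset.1 hy)) hxy
      change ENNReal.ofReal r < edist x y at this
      rw [edist_dist] at this
      exact ((ENNReal.ofReal_lt_ofReal_iff (dist_pos.2 hxy)).1 this).le
  have hcov := (Metric.coveringNumber_le_packingNumber r.toNNReal K).trans hpack
  obtain ⟨F, hFK, -, hF, hFc⟩ := Metric.exists_set_encard_eq_coveringNumber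
    (ne_top_of_le_ne_top (ENat.natCast_ne_top _) hcov)
  refine ⟨F, hFK, ?_, fun x hx => ?_⟩
  · rw [← hFc] at hcov
    calc (F.encard : ENNReal) ≤ ((⌊B⌋₊ : ℕ∞) : ENNReal) := by exact_mod_cast hcov
      _ = ENNReal.ofReal (⌊B⌋₊ : ℝ) := by simp
      _ ≤ ENNReal.ofReal B := ENNReal.ofReal_le_ofReal (Nat.floor_le (by positivity))
  · have := Metric.isCover_iff_subset_iUnion_closedBall.1 hF hx
    simpa [Real.coe_toNNReal r hr.le] using this

theorem entropy_le_of_norm_sol_sub_le (f : ℝ → E → E) (t₀ : ℝ) {K : Set E}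
    (hK : IsCompact K) {L κ : ℝ} (hL : 0 < L) (hκ : 0 < κ)
    (h : ∀ x ∈ K, ∀ y ∈ K, ∀ t, t₀ ≤ t →
      ‖sol f t t₀ y - sol f t t₀ x‖ ≤ L * Real.exp (κ * (t - t₀)) * ‖y - x‖) :
    entropy f t₀ K ≤ ((Module.finrank ℝ E * κ : ℝ) : EReal) := by
  refine iSup₂_le fun ε hε => ?_
  obtain ⟨C, hC, hcov⟩ := exists_finite_cover_encard_le hK.isBounded
  set n := Module.finrank ℝ E
  set A : ℝ := C * (2 * L / ε) ^ n with hA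
  have hA0 : 0 < A := by positivity
  have hev : ∀ᶠ T : ℝ in atTop, ENNReal.log (spanCard f t₀ ε T K : ENNReal) / (T : EReal) ≤
      ((Real.log A / T + n * κ : ℝ) : EReal) := by
    have hexp : Tendsto (fun T : ℝ => Real.exp (κ * T)) atTop atTop :=
      Real.tendsto_exp_atTop.comp (tendsto_id.const_mul_atTop hκ)
    filter_upwards [eventually_gt_atTop (0 : ℝ), hexp.eventually_ge_atTop (ε / (2 * L))]
      with T hT hTe
    -- After expansion by `L e^{κT}` this radius becomes `ε / 2`, giving the strict inequality that
    -- spanning demands. Since `κ > 0`, it is at most `1` for large `T`.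
    set r : ℝ := ε / (2 * L * Real.exp (κ * T)) with hr
    have hr0 : 0 < r := by positivity
    have hr1 : r ≤ 1 := by
      rw [hr, div_le_one (by positivity)]
      rwa [div_le_iff₀ (by positivity), mul_comm] at hTe
    obtain ⟨F, hFK, hFc, hF⟩ := hcov r hr0 hr1
    have hspan : IsSpanning f t₀ ε T K F := by
      refine ⟨hFK, fun y hy => ?_⟩
      obtain ⟨x, hx, hxy⟩ := hF y hy
      refine mem_iUnion₂.2 ⟨x, hx, fun t ht => ?_⟩
      rw [dist_eq_norm] at hxy
      have ht2 : t - t₀ ≤ T := by linarith [ht.2]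
      calc ‖sol f t t₀ y - sol f t t₀ x‖ ≤ L * Real.exp (κ * (t - t₀)) * ‖y - x‖ :=
            h x (hFK hx) y hy t ht.1
        _ ≤ L * Real.exp (κ * T) * r := by gcongr
        _ = ε / 2 := by rw [hr]; field_simp
        _ < ε := half_lt_self hε
    have hcard : (spanCard f t₀ ε T K : ENNReal) ≤ ENNReal.ofReal (A * Real.exp (n * κ * T)) := by
      have h1 : spanCard f t₀ ε T K ≤ F.encard := iInf₂_le F hspan
      refine le_trans (by exact_mod_cast h1) (hFc.trans_eq ?_)
      -- Here `C r^{-n} = A e^{nκT}`: the constant `A` disappears after taking logarithms and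
      -- dividing by `T`.
      congr 1
      rw [hA, hr, mul_assoc C, mul_assoc (n : ℝ), Real.exp_nat_mul, ← mul_pow]
      congr 2
      field_simp
    have hlog := ENNReal.log_monotone hcard
    rw [ENNReal.log_ofReal_of_pos (by positivity), Real.log_mul hA0.ne' (Real.exp_pos _).ne',
      Real.log_exp] at hlog
    refine (EReal.div_le_div_right_of_nonneg (by exact_mod_cast hT.le) hlog).trans_eq ?_
    rw [← EReal.coe_div]
    congr 1
    field_simp
  have hlim : Tendsto (fun T : ℝ => ((Real.log A / T + n * κ : ℝ) : EReal)) atTop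
      (𝓝 ((n * κ : ℝ) : EReal)) := by
    refine (continuous_coe_real_ereal.tendsto _).comp ?_
    have := (tendsto_const_nhds (x := Real.log A)).div_atTop tendsto_id
    simpa using this.add_const (n * κ)
  exact (limsup_le_limsup hev).trans_eq hlim.limsup_eq

end TVEntropy

theorem proposition2 {E : Type*} [NormedAddCommGroup E] [NormedSpace ℝ E] [FiniteDimensional ℝ E]
    (f : ℝ → E → E) (t₀ : ℝ) (hf : TVEntropy.IsPiecewiseC1 f t₀)
    (hfc : TVEntropy.ForwardComplete f t₀)
    (K : Set E) (hK : IsCompact K) (hKint : (interior K).Nonempty) :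
    TVEntropy.entropy f t₀ K ≤
      (Module.finrank ℝ E : EReal) * max (TVEntropy.muHatStar f t₀ K) 0 := by
  -- In dimension zero `‖I‖ = 0`, so the limit defining the matrix measure does not exist; the
  -- entropy is bounded directly.
  rcases subsingleton_or_nontrivial E with hE | hE
  · rw [Module.finrank_zero_of_subsingleton]
    simpa using TVEntropy.entropy_nonpos_of_subsingleton f t₀ K
  obtain ⟨D, hD⟩ := hf.exists_isExceptionalSet
  have hn : (0 : ℝ) < Module.finrank ℝ E := by exact_mod_cast Module.finrank_pos
  set m := max (TVEntropy.muHatStar f t₀ K) 0 with hm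
  have hκ : ∀ κ : ℝ, m < κ →
      TVEntropy.entropy f t₀ K ≤ ((Module.finrank ℝ E * κ : ℝ) : EReal) := by
    intro κ hκ
    obtain ⟨c, hmc, hcκ⟩ := EReal.lt_iff_exists_real_btwn.1 hκ
    have hcκ' : c < κ := by exact_mod_cast hcκ
    have hκ0 : 0 < κ := by
      have : (0 : EReal) < κ := (le_max_right _ _).trans_lt hκ
      exact_mod_cast this
    have hlt : TVEntropy.muHatStar f t₀ K < c := (le_max_left _ _).trans_lt hmc
    simp only [TVEntropy.muHatStar, iInf_lt_iff] at hlt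
    obtain ⟨t₁, ht₁, hlim⟩ := hlt
    obtain ⟨s, hs⟩ := eventually_atTop.1 (eventually_lt_of_limsup_lt hlim)
    obtain ⟨L, hL, hsep⟩ := TVEntropy.exists_norm_sol_sub_le hD hfc hK ht₁ (le_max_left t₁ s)
      hκ0.le hcκ' (fun t ht v hv => by
        have := (le_iSup₂_of_le v hv le_rfl).trans (hs t ((le_max_right _ _).trans ht)).le
        exact_mod_cast this)
    exact TVEntropy.entropy_le_of_norm_sol_sub_le f t₀ hK hL hκ0 hsep
  by_cases htop : m = ⊤
  · rw [htop, EReal.mul_top_of_pos (by exact_mod_cast hn)]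
    exact le_top
  have hbot : m ≠ ⊥ := ne_of_gt (EReal.bot_lt_zero.trans_le (le_max_right _ _))
  lift m to ℝ using ⟨htop, hbot⟩ with m'
  refine EReal.le_of_forall_lt_iff_le.1 fun z hz => ?_
  have hz' : Module.finrank ℝ E * m' < z := by exact_mod_cast hz
  -- The factor `n` is positive, so every real `z > n m'` has the form `n κ` with `κ > m'`.
  have := hκ (z / Module.finrank ℝ E) (by
    rw [EReal.coe_lt_coe_iff, lt_div_iff₀ hn]
    linarith)
  rwa [mul_div_cancel₀ _ hn.ne'] at this
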